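/- Let $d\ge 1$, let $\alpha_1,\dots,\alpha_d$ be positive numbers, let $\rho$ be a $\sigma$-finite Borel measure on $(0,\infty)^d$, and let $\nu^{(1)},\nu^{(2)}$ be $\sigma$-finite Borel measures on $[0,\infty)^d$. For a Borel set $B\subset\mathbb R^d$ put $$(\nu\circledast\rho)(B)=\int \nu\bigl(T_{x}^{-1}(B)\bigr)\,\rho(dx),\qquad T_x=\mathrm{diag}(x_1,\dots,x_d)$$ (measures on $(0,\infty)^d$ and $[0,\infty)^d$ being regarded as measures on $\mathbb R^d$). Suppose that $K\subseteq\{1,\dots,d\}$ is a non-empty set such that 1. $\nu^{(i)}\bigl(\{x:\ x_k=0\text{ for each }k\in K\}\bigr)=0$ for $i=1,2$; 2. $\int_{(0,\infty)^d}x_j^{\alpha_j}\,\rho(dx)<\infty$ for each $j\in K$; 3. $\sup_{s>0}s^{\alpha_j}\,\nu^{(i)}\bigl(\{x:\ x_j>s\}\bigr)<\infty$ for $i=1,2$ and each $j\in K$. If $\nu^{(1)}\circledast\rho=\nu^{(2)}\circledast\rho$ and $$\int_{(0,\infty)^d}x_j^{\alpha_j}\prod_{k=1}^d x_k^{i\theta_k}\,\rho(dx)\neq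 0\qquad\text{for each } j\in K\text{ and all }\theta_1,\dots,\theta_d\in\mathbb R$$ (here $i$ in the exponent is the imaginary unit), then $\nu^{(1)}=\nu^{(2)}$. -/

import Mathlib

open MeasureTheory
open scoped ENNReal

/-- The open positive orthant `(0,∞)^d` in `ℝ^d`. -/
def posOrthant (d : ℕ) : Set (Fin d → ℝ) := {x | ∀ k, 0 < x k}

/-- The closed nonnegative orthant `[0,∞)^d` in `ℝ^d`. -/
def nonnegOrthant (d : ℕ) : Set (Fin d → ℝ) := {x | ∀ k, 0 ≤ x k}

/-- The multiplicative convolution `ν ⊛ ρ` of two measures on `ℝ^d`: the image of the product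
measure under coordinatewise multiplication. See `multConv_apply` for the defining formula
`(ν ⊛ ρ)(B) = ∫ ν(T_x⁻¹ B) ρ(dx)`, `T_x = diag(x)`. -/
noncomputable def multConv {d : ℕ} (ν ρ : Measure (Fin d → ℝ)) : Measure (Fin d → ℝ) :=
  (ρ.prod ν).map fun p k => p.1 k * p.2 k

theorem multConv_apply {d : ℕ} (ν ρ : Measure (Fin d → ℝ)) [SigmaFinite ν]
    {B : Set (Fin d → ℝ)} (hB : MeasurableSet B) :
    multConv ν ρ B = ∫⁻ x, ν ((fun y => (Matrix.diagonal x).mulVec y) ⁻¹' B) ∂ρ := by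
  have hm : Measurable fun (p : (Fin d → ℝ) × (Fin d → ℝ)) (k : Fin d) => p.1 k * p.2 k := by
    fun_prop
  rw [multConv, Measure.map_apply hm hB, Measure.prod_apply (hm hB)]
  refine lintegral_congr fun x => congrArg ν ?_
  ext y
  have h : (Matrix.diagonal x).mulVec y = fun k => x k * y k := by
    ext k
    exact Matrix.mulVec_diagonal x y k
  simp only [Set.mem_preimage, h]

/-! The orthant splits into faces according to which coordinates vanish, and multiplication by a
positive vector preserves each face. A face meeting no direction of `K` is null for both measures.
On any other face pick `j ∈ K` among the nonzero coordinates, weight by `x_j ^ α_j` and take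
logarithms. The equation becomes `η * m₁ = η * m₂` (`map_add_tiltedLog`), where `η` is finite by the
moment condition and has nowhere vanishing characteristic function, and the tail condition bounds
each `mᵢ` on unit strips (`stripBounded_tiltedLog`).

The `mᵢ` may be infinite, so Fourier transforms cannot simply be divided; `eq_of_map_add_prod_eq` is
a Wiener-type substitute. Let `F` be the difference of the two integrals of a translated
band-limited function near frequency `ξ`. Then `F` is bounded, is reproduced by a kernel, and is
annihilated by `η`. On a narrow band `η` acts almost as the scalar `charFun η ξ ≠ 0`, so a
contraction estimate gives `F = 0`. Fixed band-limited weights then carry this to equality of finite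
measures `|ψ(x + ·)|² mᵢ`, and averaging over `x` removes the weight. -/

section Wiener

set_option linter.unusedSectionVars false

/-! ### Integration against strip-bounded measures -/

variable {V : Type*} [NormedAddCommGroup V] [InnerProductSpace ℝ V] [FiniteDimensional ℝ V]
  [MeasurableSpace V] [BorelSpace V]

/-- The measure `m` is uniformly bounded on the strips `{s < ℓ ≤ s + 1}`. -/
def StripBounded (ℓ : V →L[ℝ] ℝ) (m : Measure V) : Prop :=
  ∃ C : ℝ≥0∞, C ≠ ∞ ∧ ∀ s : ℝ, m {y | s < ℓ y ∧ ℓ y ≤ s + 1} ≤ C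

/-- The function `φ` is continuous and decays quadratically in the direction of `ℓ`. -/
def StripDecay (ℓ : V →L[ℝ] ℝ) (φ : V → ℂ) : Prop :=
  Continuous φ ∧ ∃ D : ℝ, ∀ y, ‖φ y‖ ≤ D * (1 + ℓ y ^ 2)⁻¹

/-- For `s` in the unit window below `t` one has `1 + s² ≤ 3 (1 + t²)`. The majorant thus becomes a
superposition of windows, which strip bounds control. -/
theorem ofReal_inv_one_add_sq_le_lintegral (t : ℝ) :
    ENNReal.ofReal ((1 + t ^ 2)⁻¹) ≤
      ∫⁻ s : ℝ, 3 * ENNReal.ofReal ((1 + s ^ 2)⁻¹) * Set.indicator (Set.Ico (t - 1) t) 1 s := by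
  calc ENNReal.ofReal ((1 + t ^ 2)⁻¹)
      = ∫⁻ s in Set.Ico (t - 1) t, ENNReal.ofReal ((1 + t ^ 2)⁻¹) := by simp
    _ ≤ ∫⁻ s in Set.Ico (t - 1) t, 3 * ENNReal.ofReal ((1 + s ^ 2)⁻¹) := by
        refine setLIntegral_mono' measurableSet_Ico fun s hs => ?_
        rw [show (3 : ℝ≥0∞) = ENNReal.ofReal 3 by simp, ← ENNReal.ofReal_mul (by norm_num)]
        refine ENNReal.ofReal_le_ofReal ?_
        rw [← div_eq_mul_inv, inv_eq_one_div, div_le_div_iff₀ (by positivity) (by positivity)]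
        have h1 := hs.1
        have h2 := hs.2
        nlinarith [sq_nonneg (s + t), sq_nonneg (s - 2 * t), sq_nonneg (t + (t - s))]
    _ = _ := by
        rw [← lintegral_indicator measurableSet_Ico]
        refine lintegral_congr fun s => ?_
        by_cases h : s ∈ Set.Ico (t - 1) t <;> simp [h]

theorem StripBounded.exists_lintegral_le {ℓ : V →L[ℝ] ℝ} {m : Measure V} [SFinite m]
    (hm : StripBounded ℓ m) :
    ∃ B : ℝ≥0∞, B ≠ ∞ ∧ ∀ a : ℝ, ∫⁻ y, ENNReal.ofReal ((1 + (a + ℓ y) ^ 2)⁻¹) ∂m ≤ B := by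
  obtain ⟨C, hC, h⟩ := hm
  have hfin : ∫⁻ s : ℝ, ENNReal.ofReal ((1 + s ^ 2)⁻¹) ≠ ∞ :=
    integrable_inv_one_add_sq.lintegral_lt_top.ne
  refine ⟨(∫⁻ s : ℝ, 3 * ENNReal.ofReal ((1 + s ^ 2)⁻¹)) * C, ?_, fun a => ?_⟩
  · rw [lintegral_const_mul _ (by fun_prop)]
    exact ENNReal.mul_ne_top (ENNReal.mul_ne_top (by simp) hfin) hC
  have hset : MeasurableSet {p : V × ℝ | p.2 ∈ Set.Ico (a + ℓ p.1 - 1) (a + ℓ p.1)} := by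
    simp only [Set.mem_Ico]
    exact (measurableSet_le (f := fun p : V × ℝ => a + ℓ p.1 - 1) (by fun_prop)
      measurable_snd).inter
      (measurableSet_lt (g := fun p : V × ℝ => a + ℓ p.1) measurable_snd (by fun_prop))
  have hmeas : Measurable fun p : V × ℝ =>
      (Set.Ico (a + ℓ p.1 - 1) (a + ℓ p.1)).indicator (1 : ℝ → ℝ≥0∞) p.2 :=
    (measurable_one.indicator hset : Measurable (Set.indicator
      {p : V × ℝ | p.2 ∈ Set.Ico (a + ℓ p.1 - 1) (a + ℓ p.1)} (1 : V × ℝ → ℝ≥0∞)))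
  calc ∫⁻ y, ENNReal.ofReal ((1 + (a + ℓ y) ^ 2)⁻¹) ∂m
      ≤ ∫⁻ y, (∫⁻ s : ℝ, 3 * ENNReal.ofReal ((1 + s ^ 2)⁻¹) *
          Set.indicator (Set.Ico (a + ℓ y - 1) (a + ℓ y)) 1 s) ∂m :=
        lintegral_mono fun y => ofReal_inv_one_add_sq_le_lintegral _
    _ = ∫⁻ s : ℝ, ∫⁻ y, 3 * ENNReal.ofReal ((1 + s ^ 2)⁻¹) *
          Set.indicator (Set.Ico (a + ℓ y - 1) (a + ℓ y)) 1 s ∂m := by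
        refine lintegral_lintegral_swap (Measurable.aemeasurable ?_)
        exact Measurable.mul (by fun_prop) hmeas
    _ ≤ ∫⁻ s : ℝ, 3 * ENNReal.ofReal ((1 + s ^ 2)⁻¹) * C := by
        refine lintegral_mono fun s => ?_
        dsimp only
        rw [lintegral_const_mul _ (by exact hmeas.comp (measurable_prodMk_right (y := s)))]
        gcongr
        -- The window `a + ℓ y - 1 ≤ s < a + ℓ y` is exactly the strip at `s - a`, so the bound does
        -- not depend on `a`.
        refine le_trans (le_of_eq ?_) (h (s - a))
        rw [← lintegral_indicator_one]
        · refine lintegral_congr fun y => ?_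
          simp only [Set.indicator, Set.mem_Ico, Set.mem_ofPred_eq]
          congr 1
          exact propext ⟨fun h => ⟨by linarith [h.2], by linarith [h.1]⟩,
            fun h => ⟨by linarith [h.2], by linarith [h.1]⟩⟩
        · exact (measurableSet_lt measurable_const ℓ.measurable).inter
            (measurableSet_le ℓ.measurable measurable_const)
    _ = _ := lintegral_mul_const _ (by fun_prop)

theorem StripDecay.exists_integral_norm_le {ℓ : V →L[ℝ] ℝ} {m : Measure V} [SFinite m]
    {φ : V → ℂ} (hφ : StripDecay ℓ φ) (hm : StripBounded ℓ m) :
    ∃ B : ℝ, 0 ≤ B ∧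
      ∀ x, Integrable (fun y => φ (x + y)) m ∧ ∫ y, ‖φ (x + y)‖ ∂m ≤ B := by
  obtain ⟨hc, D, hD⟩ := hφ
  obtain ⟨B, hB, h⟩ := hm.exists_lintegral_le
  have hle : ∀ x, ∫⁻ y, ENNReal.ofReal ‖φ (x + y)‖ ∂m ≤ ENNReal.ofReal D * B := fun x => by
    calc ∫⁻ y, ENNReal.ofReal ‖φ (x + y)‖ ∂m
        ≤ ∫⁻ y, ENNReal.ofReal D * ENNReal.ofReal ((1 + (ℓ x + ℓ y) ^ 2)⁻¹) ∂m := by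
          refine lintegral_mono fun y => ?_
          rw [← ENNReal.ofReal_mul' (by positivity), ← map_add]
          exact ENNReal.ofReal_le_ofReal (hD _)
      _ = ENNReal.ofReal D * ∫⁻ y, ENNReal.ofReal ((1 + (ℓ x + ℓ y) ^ 2)⁻¹) ∂m :=
          lintegral_const_mul _ (by fun_prop)
      _ ≤ _ := by gcongr; exact h _
  have htop : ENNReal.ofReal D * B ≠ ∞ := ENNReal.mul_ne_top (by simp) hB
  have hcx : ∀ x, Continuous fun y => φ (x + y) := fun x => by fun_prop
  refine ⟨(ENNReal.ofReal D * B).toReal, ENNReal.toReal_nonneg, fun x => ⟨?_, ?_⟩⟩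
  · refine ⟨(hcx x).aestronglyMeasurable, ?_⟩
    rw [hasFiniteIntegral_iff_norm]
    exact (hle x).trans_lt htop.lt_top
  · rw [integral_eq_lintegral_of_nonneg_ae (.of_forall fun _ => norm_nonneg _)
      (hcx x).norm.aestronglyMeasurable]
    exact ENNReal.toReal_mono htop (hle x)

/-! ### Convolution identities and the contraction argument -/

theorem integral_eq_integral_mul_integral_sub {ℓ : V →L[ℝ] ℝ} {m : Measure V} [SFinite m]
    {φ χ : V → ℂ} (hφ : StripDecay ℓ φ) (hm : StripBounded ℓ m) (hχ : Integrable χ)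
    (hrep : ∀ y, ∫ z, χ z * φ (y - z) = φ y) (x : V) :
    ∫ y, φ (x + y) ∂m = ∫ z, χ z * ∫ y, φ (x - z + y) ∂m := by
  obtain ⟨B, hB0, hB⟩ := hφ.exists_integral_norm_le hm
  have hφc := hφ.1
  have hint : Integrable (Function.uncurry fun y z => χ z * φ (x - z + y)) (m.prod volume) := by
    have hmeas : AEStronglyMeasurable (Function.uncurry fun y z => χ z * φ (x - z + y))
        (m.prod volume) :=
      hχ.1.comp_snd.mul (Continuous.aestronglyMeasurable (by fun_prop))
    refine (integrable_prod_iff' hmeas).2 ⟨.of_forall fun z => ?_, ?_⟩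
    · exact (hB (x - z)).1.const_mul (χ z)
    · refine (hχ.norm.mul_const B).mono' hmeas.norm.prod_swap.integral_prod_right'
        (.of_forall fun z => ?_)
      simp only [Function.uncurry, norm_mul]
      rw [integral_const_mul, Real.norm_of_nonneg
        (mul_nonneg (norm_nonneg _) (integral_nonneg fun _ => norm_nonneg _))]
      gcongr
      exact (hB _).2
  calc ∫ y, φ (x + y) ∂m = ∫ y, (∫ z, χ z * φ (x - z + y)) ∂m := by
        refine integral_congr_ae (.of_forall fun y => ?_)
        dsimp only
        rw [← hrep (x + y)]
        refine integral_congr_ae (.of_forall fun z => ?_)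
        dsimp only
        rw [sub_add_eq_add_sub]
    _ = ∫ z, ∫ y, χ z * φ (x - z + y) ∂m := integral_integral_swap hint
    _ = _ := by simp_rw [integral_const_mul]

theorem integral_integral_add_eq {ℓ : V →L[ℝ] ℝ} {m η : Measure V} [SFinite m]
    [IsFiniteMeasure η] {φ : V → ℂ} (hφ : StripDecay ℓ φ) (hm : StripBounded ℓ m) (x : V) :
    ∫ u, ∫ y, φ (x + u + y) ∂m ∂η = ∫ w, φ (x + w) ∂(η.prod m).map fun p => p.1 + p.2 := by
  obtain ⟨B, hB0, hB⟩ := hφ.exists_integral_norm_le hm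
  have hφc := hφ.1
  rw [integral_map (by fun_prop) (Continuous.aestronglyMeasurable (by fun_prop))]
  rw [integral_prod]
  · simp_rw [add_assoc]
  have hmeas : AEStronglyMeasurable (fun p : V × V => φ (x + (p.1 + p.2))) (η.prod m) :=
    Continuous.aestronglyMeasurable (by fun_prop)
  refine (integrable_prod_iff hmeas).2 ⟨.of_forall fun u => ?_, ?_⟩
  · simpa only [add_assoc] using (hB (x + u)).1
  · refine (integrable_const B).mono' hmeas.norm.integral_prod_right' (.of_forall fun u => ?_)
    rw [Real.norm_of_nonneg (integral_nonneg fun _ => norm_nonneg _)]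
    simpa only [add_assoc] using (hB (x + u)).2

/-- The difference `F` satisfies `F = χ ⋆ F`, and its `η`-averages vanish, so the kernel `∫ u, χ (z
+ u) ∂η` annihilates it. Hence `c F` is the convolution of `F` with a kernel of `L¹` norm below
`‖c‖`, which forces `sup ‖F‖ = 0`. -/
theorem integral_sub_integral_eq_zero_of_integral_norm_lt {ℓ : V →L[ℝ] ℝ}
    {m₁ m₂ η : Measure V} [SFinite m₁] [SFinite m₂] [IsFiniteMeasure η] {φ χ : V → ℂ}
    (hφ : StripDecay ℓ φ) (hm₁ : StripBounded ℓ m₁) (hm₂ : StripBounded ℓ m₂)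
    (hχ : Integrable χ) (hχc : Continuous χ) (hrep : ∀ y, ∫ z, χ z * φ (y - z) = φ y)
    (hconv : (η.prod m₁).map (fun p => p.1 + p.2) = (η.prod m₂).map fun p => p.1 + p.2)
    (c : ℂ) (hc : ∫ z, ‖c * χ z - ∫ u, χ (z + u) ∂η‖ < ‖c‖) (x : V) :
    ∫ y, φ (x + y) ∂m₁ - ∫ y, φ (x + y) ∂m₂ = 0 := by
  obtain ⟨B₁, hB₁0, hB₁⟩ := hφ.exists_integral_norm_le hm₁
  obtain ⟨B₂, hB₂0, hB₂⟩ := hφ.exists_integral_norm_le hm₂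
  have hφc := hφ.1
  set F : V → ℂ := fun x => ∫ y, φ (x + y) ∂m₁ - ∫ y, φ (x + y) ∂m₂ with hF
  have hFm : StronglyMeasurable F := by
    have h : StronglyMeasurable fun p : V × V => φ (p.1 + p.2) :=
      Continuous.stronglyMeasurable (by fun_prop)
    exact h.integral_prod_right'.sub h.integral_prod_right'
  have hFb : ∀ x, ‖F x‖ ≤ B₁ + B₂ := fun x =>
    (norm_sub_le _ _).trans (add_le_add ((norm_integral_le_integral_norm _).trans (hB₁ x).2)
      ((norm_integral_le_integral_norm _).trans (hB₂ x).2))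
  have hmul : ∀ (g : V → ℂ) (x : V), Integrable g → Integrable fun z => g z * F (x - z) :=
    fun g x hg => hg.mul_bdd (c := B₁ + B₂)
      (hFm.comp_measurable (by fun_prop)).aestronglyMeasurable (.of_forall fun z => hFb _)
  have hI₁ : ∀ (m : Measure V) [SFinite m], StripBounded ℓ m →
      ∀ x, Integrable fun z => χ z * ∫ y, φ (x - z + y) ∂m := fun m _ hm x => by
    obtain ⟨B, hB0, hB⟩ := hφ.exists_integral_norm_le hm
    have h : StronglyMeasurable fun p : V × V => φ (x - p.1 + p.2) :=
      Continuous.stronglyMeasurable (by fun_prop)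
    exact hχ.mul_bdd (c := B) h.integral_prod_right'.aestronglyMeasurable
      (.of_forall fun z => (norm_integral_le_integral_norm _).trans (hB _).2)
  have hFrep : ∀ x, F x = ∫ z, χ z * F (x - z) := fun x => by
    simp only [hF]
    rw [integral_eq_integral_mul_integral_sub hφ hm₁ hχ hrep,
      integral_eq_integral_mul_integral_sub hφ hm₂ hχ hrep,
      ← integral_sub (hI₁ m₁ hm₁ x) (hI₁ m₂ hm₂ x)]
    simp_rw [mul_sub]
  have hFη : ∀ x, ∫ u, F (x + u) ∂η = 0 := fun x => by
    have hi : ∀ (m : Measure V) [SFinite m], StripBounded ℓ m →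
        Integrable (fun u => ∫ y, φ (x + u + y) ∂m) η := fun m _ hm => by
      obtain ⟨B, hB0, hB⟩ := hφ.exists_integral_norm_le hm
      have h : StronglyMeasurable fun p : V × V => φ (x + p.1 + p.2) :=
        Continuous.stronglyMeasurable (by fun_prop)
      exact (integrable_const B).mono' h.integral_prod_right'.aestronglyMeasurable
        (.of_forall fun z => (norm_integral_le_integral_norm _).trans (hB _).2)
    simp only [hF]
    rw [integral_sub (hi m₁ hm₁) (hi m₂ hm₂), integral_integral_add_eq hφ hm₁,
      integral_integral_add_eq hφ hm₂, hconv, sub_self]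
  have hχη : Integrable (fun p : V × V => χ (p.2 + p.1)) (η.prod volume) := by
    have hmeas : AEStronglyMeasurable (fun p : V × V => χ (p.2 + p.1)) (η.prod volume) :=
      Continuous.aestronglyMeasurable (by fun_prop)
    refine (integrable_prod_iff hmeas).2 ⟨.of_forall fun u => hχ.comp_add_right u, ?_⟩
    simp only [integral_add_right_eq_self (fun z => ‖χ z‖)]
    exact integrable_const _
  have hχη' : Integrable fun z => ∫ u, χ (z + u) ∂η := hχη.integral_prod_right
  have hzero : ∀ x, ∫ z, (∫ u, χ (z + u) ∂η) * F (x - z) = 0 := fun x => by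
    have hint : Integrable (Function.uncurry fun u z => χ (z + u) * F (x - z))
        (η.prod volume) :=
      hχη.mul_bdd (c := B₁ + B₂)
        (hFm.comp_measurable (by fun_prop : Measurable fun p : V × V => x - p.2)).aestronglyMeasurable
        (.of_forall fun p => hFb _)
    calc ∫ z, (∫ u, χ (z + u) ∂η) * F (x - z)
        = ∫ z, ∫ u, χ (z + u) * F (x - z) ∂η := by simp_rw [integral_mul_const]
      _ = ∫ u, (∫ z, χ (z + u) * F (x - z)) ∂η := (integral_integral_swap hint).symm
      _ = ∫ u, F (x + u) ∂η := by
          refine integral_congr_ae (.of_forall fun u => ?_)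
          dsimp only
          rw [hFrep (x + u), ← integral_add_right_eq_self (fun z => χ z * F (x + u - z)) u]
          refine integral_congr_ae (.of_forall fun z => ?_)
          dsimp only
          rw [add_sub_add_right_eq_sub]
      _ = 0 := hFη x
  have hcF : ∀ x, c * F x = ∫ z, (c * χ z - ∫ u, χ (z + u) ∂η) * F (x - z) := fun x => by
    simp_rw [sub_mul]
    rw [integral_sub, hzero, sub_zero, hFrep x, ← integral_const_mul]
    · simp_rw [mul_assoc]
    · exact hmul _ x (hχ.const_mul c)
    · exact hmul _ x hχη'
  have hki : Integrable fun z => c * χ z - ∫ u, χ (z + u) ∂η := (hχ.const_mul c).sub hχη'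
  set q := ∫ z, ‖c * χ z - ∫ u, χ (z + u) ∂η‖ with hq
  have hbdd : BddAbove (Set.range fun x => ‖F x‖) :=
    ⟨B₁ + B₂, by rintro _ ⟨x, rfl⟩; exact hFb x⟩
  set M := ⨆ x, ‖F x‖
  have hFM : ∀ x, ‖F x‖ ≤ M := fun x => le_ciSup hbdd x
  have hstep : ∀ x, ‖c‖ * ‖F x‖ ≤ q * M := fun x => by
    rw [← norm_mul, hcF, hq, ← integral_mul_const]
    refine norm_integral_le_of_norm_le (hki.norm.mul_const M) (.of_forall fun z => ?_)
    rw [norm_mul]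
    gcongr
    exact hFM _
  have hc0 : 0 < ‖c‖ := lt_of_le_of_lt (integral_nonneg fun _ => norm_nonneg _) hc
  have hM0 : M ≤ 0 := by
    have h1 : M ≤ q * M / ‖c‖ := ciSup_le fun x => by
      rw [le_div_iff₀ hc0, mul_comm]
      exact hstep x
    rw [le_div_iff₀ hc0] at h1
    nlinarith
  exact norm_le_zero_iff.1 ((hFM x).trans hM0)

/-! ### Modulation by plane waves -/

open Filter Topology FourierTransform SchwartzMap ComplexConjugate

/-- The plane wave `y ↦ exp (i ⟪y, ξ⟫)`. -/
noncomputable def planeWave (ξ y : V) : ℂ := Complex.exp ((inner ℝ y ξ : ℝ) * Complex.I)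

theorem continuous_planeWave₂ : Continuous fun p : V × V => planeWave p.1 p.2 := by
  unfold planeWave; fun_prop

@[fun_prop]
theorem Continuous.planeWave {X : Type*} [TopologicalSpace X] {f g : X → V} (hf : Continuous f)
    (hg : Continuous g) : Continuous fun x => planeWave (f x) (g x) :=
  continuous_planeWave₂.comp (hf.prodMk hg)

@[simp]
theorem norm_planeWave (ξ y : V) : ‖planeWave ξ y‖ = 1 := Complex.norm_exp_ofReal_mul_I _

theorem planeWave_add (ξ x y : V) : planeWave ξ (x + y) = planeWave ξ x * planeWave ξ y := by
  simp [planeWave, inner_add_left, add_mul, Complex.exp_add]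

theorem planeWave_add_left (ξ ξ' y : V) :
    planeWave (ξ + ξ') y = planeWave ξ y * planeWave ξ' y := by
  simp [planeWave, inner_add_right, add_mul, Complex.exp_add]

theorem conj_planeWave (ξ y : V) : conj (planeWave ξ y) = planeWave (-ξ) y := by
  simp [planeWave, ← Complex.exp_conj]

theorem charFun_eq_integral_planeWave (η : Measure V) (ξ : V) :
    charFun η ξ = ∫ u, planeWave ξ u ∂η := rfl

/-- Modulating both `φ` and `χ` by the same plane wave keeps the reproducing identity. With `c =
charFun η ξ` the contraction kernel is, up to a unimodular factor, the `η`-average of `(χ z - χ (z +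
u)) * planeWave ξ u`, so only the translation defect of `χ` matters. -/
theorem integral_mul_planeWave_eq {ℓ : V →L[ℝ] ℝ}
    {m₁ m₂ η : Measure V} [SFinite m₁] [SFinite m₂] [IsFiniteMeasure η] {φ χ : V → ℂ}
    (hφ : StripDecay ℓ φ) (hm₁ : StripBounded ℓ m₁) (hm₂ : StripBounded ℓ m₂)
    (hχ : Integrable χ) (hχc : Continuous χ) (hrep : ∀ y, ∫ z, χ z * φ (y - z) = φ y)
    (hconv : (η.prod m₁).map (fun p => p.1 + p.2) = (η.prod m₂).map fun p => p.1 + p.2)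
    (ξ : V) (hξ : ∫ u, (∫ z, ‖χ z - χ (z + u)‖) ∂η < ‖charFun η ξ‖) :
    ∫ y, φ y * planeWave ξ y ∂m₁ = ∫ y, φ y * planeWave ξ y ∂m₂ := by
  have hφ' : StripDecay ℓ fun y => φ y * planeWave ξ y := by
    obtain ⟨hc, D, hD⟩ := hφ
    exact ⟨by fun_prop, D, fun y => by simpa using hD y⟩
  have hχ' : Integrable fun z => χ z * planeWave ξ z :=
    hχ.mul_bdd (c := 1) (Continuous.aestronglyMeasurable (by fun_prop))
      (.of_forall fun z => by simp)
  have hrep' : ∀ y, ∫ z, χ z * planeWave ξ z * (φ (y - z) * planeWave ξ (y - z)) =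
      φ y * planeWave ξ y := fun y => by
    rw [← hrep y, ← integral_mul_const]
    refine integral_congr_ae (.of_forall fun z => ?_)
    dsimp only
    rw [show planeWave ξ y = planeWave ξ z * planeWave ξ (y - z) by
      rw [← planeWave_add, add_sub_cancel]]
    ring
  have hχη : Integrable (fun p : V × V => χ p.2 - χ (p.2 + p.1)) (η.prod volume) := by
    refine Integrable.sub (hχ.comp_snd η) ?_
    have hmeas : AEStronglyMeasurable (fun p : V × V => χ (p.2 + p.1)) (η.prod volume) :=
      Continuous.aestronglyMeasurable (by fun_prop)
    refine (integrable_prod_iff hmeas).2 ⟨.of_forall fun u => hχ.comp_add_right u, ?_⟩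
    simp only [integral_add_right_eq_self (fun z => ‖χ z‖)]
    exact integrable_const _
  have hk : ∀ᵐ z, ‖charFun η ξ * (χ z * planeWave ξ z) -
      ∫ u, χ (z + u) * planeWave ξ (z + u) ∂η‖ ≤ ∫ u, ‖χ z - χ (z + u)‖ ∂η := by
    filter_upwards [hχη.prod_left_ae] with z hz
    have hb : ∀ g : V → ℂ, Integrable g η → Integrable (fun u => g u * planeWave ξ u) η :=
      fun g hg => hg.mul_bdd (c := 1) (Continuous.aestronglyMeasurable (by fun_prop))
        (.of_forall fun z => by simp)
    have hz2 : Integrable (fun u => χ (z + u)) η := by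
      refine ((integrable_const (χ z)).sub hz).congr (.of_forall fun u => ?_)
      simp
    have : charFun η ξ * (χ z * planeWave ξ z) - ∫ u, χ (z + u) * planeWave ξ (z + u) ∂η =
        ∫ u, planeWave ξ z * ((χ z - χ (z + u)) * planeWave ξ u) ∂η := by
      rw [integral_const_mul]
      simp_rw [sub_mul]
      rw [integral_sub (hb _ (integrable_const _)) (hb _ hz2), integral_const_mul,
        ← charFun_eq_integral_planeWave, mul_sub, ← integral_const_mul]
      congr 1
      · ring
      · refine integral_congr_ae (.of_forall fun u => ?_)
        dsimp only
        rw [planeWave_add]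
        ring
    rw [this]
    refine norm_integral_le_of_norm_le hz.norm (.of_forall fun u => ?_)
    simp
  have hlt : ∫ z, ‖charFun η ξ * (χ z * planeWave ξ z) -
      ∫ u, χ (z + u) * planeWave ξ (z + u) ∂η‖ < ‖charFun η ξ‖ := by
    refine lt_of_le_of_lt ?_ hξ
    rw [integral_integral_swap hχη.norm]
    exact integral_mono_of_nonneg (.of_forall fun _ => norm_nonneg _) hχη.norm.integral_prod_right hk
  have := integral_sub_integral_eq_zero_of_integral_norm_lt hφ' hm₁ hm₂ hχ' (by fun_prop) hrep'
    hconv _ hlt 0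
  simpa [sub_eq_zero] using this

/-! ### Translation defects and dilation -/

theorem SchwartzMap.tendsto_integral_norm_sub_translate (χ : 𝓢(V, ℂ)) :
    Tendsto (fun u => ∫ z, ‖χ z - χ (z + u)‖) (𝓝 0) (𝓝 0) := by
  -- One more than the dimension makes `(1 + ‖z‖) ^ (-k)` integrable.
  set k := Module.finrank ℝ V + 1 with hk
  obtain ⟨D, hD⟩ : ∃ D : ℝ, ∀ z, (1 + ‖z‖) ^ k * ‖χ z‖ ≤ D :=
    ⟨_, fun z => by
      simpa using one_add_le_sup_seminorm_apply (𝕜 := ℝ) (m := (k, 0)) le_rfl le_rfl χ z⟩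
  have hint : Integrable fun z : V => ((1 + ‖z‖) ^ k)⁻¹ := by
    have := integrable_one_add_norm (E := V) (μ := volume) (r := k) (by rw [hk]; push_cast; linarith)
    refine this.congr (.of_forall fun z => ?_)
    dsimp only
    rw [Real.rpow_neg (by positivity), Real.rpow_natCast]
  rw [show (0 : ℝ) = ∫ z : V, (0 : ℝ) by simp]
  refine tendsto_integral_filter_of_dominated_convergence
    (fun z => ‖χ z‖ + D * 2 ^ k * ((1 + ‖z‖) ^ k)⁻¹) ?_ ?_ ?_ ?_
  · have := χ.continuous
    exact .of_forall fun u => Continuous.aestronglyMeasurable (by fun_prop)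
  · filter_upwards [Metric.closedBall_mem_nhds (0 : V) one_pos] with u hu
    refine .of_forall fun z => ?_
    rw [norm_norm]
    refine (norm_sub_le _ _).trans (add_le_add le_rfl ?_)
    have hu' : ‖u‖ ≤ 1 := by simpa using hu
    have h1 : ‖z‖ ≤ ‖z + u‖ + ‖u‖ := by
      simpa using norm_sub_le (z + u) u
    -- Translations by `‖u‖ ≤ 1` cost a factor `2 ^ k`, which gives a majorant independent of `u`.
    have h2 : (1 + ‖z‖) ^ k ≤ (2 * (1 + ‖z + u‖)) ^ k := by
      gcongr
      linarith [norm_nonneg (z + u)]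
    rw [← div_eq_mul_inv, le_div_iff₀ (by positivity)]
    calc ‖χ (z + u)‖ * (1 + ‖z‖) ^ k ≤ ‖χ (z + u)‖ * (2 * (1 + ‖z + u‖)) ^ k := by gcongr
      _ = (1 + ‖z + u‖) ^ k * ‖χ (z + u)‖ * 2 ^ k := by rw [mul_pow]; ring
      _ ≤ D * 2 ^ k := by gcongr; exact hD _
  · exact χ.integrable.norm.add (hint.const_mul _)
  · refine .of_forall fun z => ?_
    have h : Continuous fun u => ‖χ z - χ (z + u)‖ := by
      have := χ.continuous
      fun_prop
    simpa using h.tendsto 0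

theorem SchwartzMap.tendsto_integral_integral_norm_sub_translate (χ : 𝓢(V, ℂ)) (η : Measure V)
    [IsFiniteMeasure η] :
    Tendsto (fun t : ℝ => ∫ u, (∫ z, ‖χ z - χ (z + t • u)‖) ∂η) (𝓝 0) (𝓝 0) := by
  have hχc := χ.continuous
  suffices h : Tendsto (fun t : ℝ => ∫ u, (∫ z, ‖χ z - χ (z + t • u)‖) ∂η) (𝓝 0)
      (𝓝 (∫ u, (0 : ℝ) ∂η)) by simpa using h
  refine tendsto_integral_filter_of_dominated_convergence
    (fun _ => (∫ z, ‖χ z‖) + ∫ z, ‖χ z‖) ?_ ?_ (integrable_const _) ?_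
  · refine .of_forall fun t => StronglyMeasurable.aestronglyMeasurable ?_
    have : StronglyMeasurable fun p : V × V => ‖χ p.2 - χ (p.2 + t • p.1)‖ :=
      Continuous.stronglyMeasurable (by fun_prop)
    exact this.integral_prod_right'
  · refine .of_forall fun t => .of_forall fun u => ?_
    rw [Real.norm_of_nonneg (integral_nonneg fun _ => norm_nonneg _)]
    have h1 := χ.integrable (μ := volume).norm
    have h2 := h1.comp_add_right (t • u)
    calc ∫ z, ‖χ z - χ (z + t • u)‖ ≤ ∫ z, (‖χ z‖ + ‖χ (z + t • u)‖) :=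
          integral_mono (χ.integrable.sub (χ.integrable.comp_add_right (t • u))).norm (h1.add h2)
            fun z => norm_sub_le _ _
      _ = _ := by rw [integral_add h1 h2, integral_add_right_eq_self (fun z => ‖χ z‖)]
  · refine .of_forall fun u => ?_
    have h : Tendsto (fun t : ℝ => t • u) (𝓝 0) (𝓝 0) := by
      simpa using (Continuous.tendsto (by fun_prop : Continuous fun t : ℝ => t • u) 0)
    exact χ.tendsto_integral_norm_sub_translate.comp h

theorem SchwartzMap.stripDecay_comp_smul (ℓ : V →L[ℝ] ℝ) (ψ : 𝓢(V, ℂ)) {t : ℝ} (ht : 0 < t) :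
    StripDecay ℓ fun y => ψ (t • y) := by
  have hψc := ψ.continuous
  obtain ⟨C₀, hC₀⟩ : ∃ C : ℝ, ∀ y, ‖ψ y‖ ≤ C := by
    obtain ⟨C, _, hC⟩ := ψ.decay 0 0
    exact ⟨C, fun y => by simpa using hC y⟩
  obtain ⟨C₂, hC₂⟩ : ∃ C : ℝ, ∀ y, ‖y‖ ^ 2 * ‖ψ y‖ ≤ C := by
    obtain ⟨C, _, hC⟩ := ψ.decay 2 0
    exact ⟨C, fun y => by simpa using hC y⟩
  refine ⟨by fun_prop, C₀ + ‖ℓ‖ ^ 2 * C₂ * (t ^ 2)⁻¹, fun y => ?_⟩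
  rw [← div_eq_mul_inv, le_div_iff₀ (by positivity)]
  have h1 : ℓ y ^ 2 ≤ ‖ℓ‖ ^ 2 * (‖t • y‖ ^ 2 * (t ^ 2)⁻¹) := by
    have h := ℓ.le_opNorm y
    rw [norm_smul, Real.norm_of_nonneg ht.le, mul_pow, mul_comm (t ^ 2), mul_assoc,
      mul_inv_cancel₀ (by positivity), mul_one, ← mul_pow, ← sq_abs, ← Real.norm_eq_abs]
    gcongr
  calc ‖ψ (t • y)‖ * (1 + ℓ y ^ 2) = ‖ψ (t • y)‖ + ℓ y ^ 2 * ‖ψ (t • y)‖ := by ring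
    _ ≤ C₀ + ‖ℓ‖ ^ 2 * (‖t • y‖ ^ 2 * (t ^ 2)⁻¹) * ‖ψ (t • y)‖ := by
        gcongr
        exact hC₀ _
    _ = C₀ + ‖ℓ‖ ^ 2 * (‖t • y‖ ^ 2 * ‖ψ (t • y)‖) * (t ^ 2)⁻¹ := by ring
    _ ≤ _ := by gcongr; exact hC₂ _

/-- Replacing `χ` by `t ^ n χ(t ·)` turns the defect at `u` into that of `χ` at `t • u`, which tends
to `0` on `η`-average. By compactness `‖charFun η‖` has a positive lower bound on the ball, so one
`t` serves all its frequencies. -/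
theorem eventually_integral_mul_planeWave_eq {ℓ : V →L[ℝ] ℝ}
    {m₁ m₂ η : Measure V} [SFinite m₁] [SFinite m₂] [IsFiniteMeasure η] {ψ χ : 𝓢(V, ℂ)}
    (hm₁ : StripBounded ℓ m₁) (hm₂ : StripBounded ℓ m₂)
    (hrep : ∀ y, ∫ z, χ z * ψ (y - z) = ψ y)
    (hconv : (η.prod m₁).map (fun p => p.1 + p.2) = (η.prod m₂).map fun p => p.1 + p.2)
    (hη : ∀ ξ, charFun η ξ ≠ 0) (R : ℝ) :
    ∀ᶠ t : ℝ in 𝓝[>] 0, ∀ ξ, ‖ξ‖ ≤ R →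
      ∫ y, ψ (t • y) * planeWave ξ y ∂m₁ = ∫ y, ψ (t • y) * planeWave ξ y ∂m₂ := by
  obtain ⟨c, hc, hcη⟩ : ∃ c > 0, ∀ ξ, ‖ξ‖ ≤ R → c ≤ ‖charFun η ξ‖ := by
    -- The ball is empty for negative `R`.
    rcases (Metric.closedBall (0 : V) R).eq_empty_or_nonempty with h | h
    · refine ⟨1, one_pos, fun ξ hξ => ?_⟩
      have : ξ ∈ Metric.closedBall (0 : V) R := by simpa using hξ
      simp [h] at this
    · have hcont : Continuous (charFun η) := continuous_charFun
      obtain ⟨ξ₀, -, h0⟩ := (isCompact_closedBall (0 : V) R).exists_isMinOn h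
        hcont.norm.continuousOn
      exact ⟨_, norm_pos_iff.2 (hη ξ₀), fun ξ hξ => h0 (by simpa using hξ)⟩
  have hlim := (χ.tendsto_integral_integral_norm_sub_translate η).mono_left
    (nhdsWithin_le_nhds (s := Set.Ioi 0))
  filter_upwards [hlim.eventually_lt_const hc, self_mem_nhdsWithin] with t ht ht0 ξ hξ
  have ht0 : 0 < t := ht0
  set n := Module.finrank ℝ V
  have hscale : ∀ {E : Type _} [NormedAddCommGroup E] [NormedSpace ℝ E] (f : V → E),
      ∫ z, f (t • z) = (t ^ n)⁻¹ • ∫ z, f z := fun f => by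
    rw [Measure.integral_comp_smul, abs_of_pos (by positivity)]
  have hχi : Integrable fun z => ((t ^ n : ℝ) : ℂ) * χ (t • z) :=
    (χ.integrable.comp_smul ht0.ne').const_mul _
  have hχc := χ.continuous
  have htn : (t ^ n : ℝ) ≠ 0 := by positivity
  refine integral_mul_planeWave_eq (χ := fun z => ((t ^ n : ℝ) : ℂ) * χ (t • z))
    (ψ.stripDecay_comp_smul ℓ ht0) hm₁ hm₂ hχi (by fun_prop) (fun y => ?_) hconv ξ
    (lt_of_eq_of_lt ?_ (ht.trans_le (hcη ξ hξ)))
  · simp_rw [smul_sub, mul_assoc]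
    rw [integral_const_mul, hscale (fun z => χ z * ψ (t • y - z)), hrep, Complex.real_smul,
      ← mul_assoc, ← Complex.ofReal_mul, mul_inv_cancel₀ htn, Complex.ofReal_one, one_mul]
  · refine integral_congr_ae (.of_forall fun u => ?_)
    dsimp only
    simp_rw [← mul_sub, norm_mul, smul_add]
    rw [integral_const_mul, hscale (fun z => ‖χ z - χ (z + t • u)‖), smul_eq_mul, ← mul_assoc,
      Complex.norm_real, Real.norm_of_nonneg (by positivity), mul_inv_cancel₀ htn, one_mul]

/-! ### Band-limited weights and cancellation -/

/-- By Fubini, a multiplier with frequencies of size at most `r` only shifts `ξ` by at most `r`; the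
price is a frequency ball smaller by `r`. -/
theorem integral_mul_superposition_eq {m₁ m₂ : Measure V} [SFinite m₁] [SFinite m₂]
    {φ b : V → ℂ} (h₁ : Integrable φ m₁) (h₂ : Integrable φ m₂) (hb : Integrable b) {r R : ℝ}
    (hbr : ∀ ζ, r < ‖ζ‖ → b ζ = 0)
    (h : ∀ ξ, ‖ξ‖ ≤ R + r →
      ∫ y, φ y * planeWave ξ y ∂m₁ = ∫ y, φ y * planeWave ξ y ∂m₂) (ξ : V) (hξ : ‖ξ‖ ≤ R) :
    ∫ y, φ y * (∫ ζ, b ζ * planeWave ζ y) * planeWave ξ y ∂m₁ =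
      ∫ y, φ y * (∫ ζ, b ζ * planeWave ζ y) * planeWave ξ y ∂m₂ := by
  have key : ∀ (m : Measure V) [SFinite m], Integrable φ m →
      ∫ y, φ y * (∫ ζ, b ζ * planeWave ζ y) * planeWave ξ y ∂m =
        ∫ ζ, b ζ * ∫ y, φ y * planeWave (ξ + ζ) y ∂m := fun m _ hm => by
    have hint : Integrable (Function.uncurry fun y ζ => φ y * b ζ * planeWave (ξ + ζ) y)
        (m.prod volume) :=
      (hm.mul_prod hb).mul_bdd (c := 1) (Continuous.aestronglyMeasurable (by fun_prop))
        (.of_forall fun z => by simp)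
    calc _ = ∫ y, (∫ ζ, φ y * b ζ * planeWave (ξ + ζ) y) ∂m := by
          refine integral_congr_ae (.of_forall fun y => ?_)
          dsimp only
          rw [← integral_const_mul, ← integral_mul_const]
          simp_rw [planeWave_add_left]
          congr 1; ext ζ; ring
      _ = ∫ ζ, ∫ y, φ y * b ζ * planeWave (ξ + ζ) y ∂m := integral_integral_swap hint
      _ = _ := by
          simp_rw [← integral_const_mul]
          congr 1; ext ζ; congr 1; ext y; ring
  rw [key m₁ h₁, key m₂ h₂]
  congr 1
  ext ζ
  by_cases hζ : r < ‖ζ‖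
  · simp [hbr ζ hζ]
  · rw [h _ ((norm_add_le _ _).trans (add_le_add hξ (not_lt.1 hζ)))]

/-- Schwartz functions `ψ`, `χ` with `χ ⋆ ψ = ψ` and `ψ` a superposition of plane waves with
bounded frequencies. -/
theorem exists_schwartz_reproducing :
    ∃ (ψ χ : 𝓢(V, ℂ)) (b : V → ℂ) (r : ℝ), (∀ y, ∫ z, χ z * ψ (y - z) = ψ y) ∧ ψ 0 ≠ 0 ∧
      Integrable b ∧ (∀ ζ, r < ‖ζ‖ → b ζ = 0) ∧ ∀ y, ψ y = ∫ ζ, b ζ * planeWave ζ y := by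
  -- The second bump equals `1` on the support of the first, so the product is the first bump;
  -- inverse Fourier transforms turn this into `χ ⋆ ψ = ψ`.
  let b₁ : ContDiffBump (0 : V) := ⟨1, 2, one_pos, one_lt_two⟩
  let b₂ : ContDiffBump (0 : V) := ⟨2, 3, two_pos, by norm_num⟩
  have hs : ∀ b : ContDiffBump (0 : V),
      ContDiff ℝ ((⊤ : ℕ∞) : WithTop ℕ∞) fun x => ((b x : ℝ) : ℂ) := fun b =>
    Complex.ofRealCLM.contDiff.comp b.contDiff
  have hcs : ∀ b : ContDiffBump (0 : V), HasCompactSupport fun x => ((b x : ℝ) : ℂ) := fun b =>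
    b.hasCompactSupport.comp_left (g := Complex.ofReal) (by simp)
  let S₁ : 𝓢(V, ℂ) := (hcs b₁).toSchwartzMap (hs b₁)
  let S₂ : 𝓢(V, ℂ) := (hcs b₂).toSchwartzMap (hs b₂)
  have hS₁ : ∀ x, S₁ x = ((b₁ x : ℝ) : ℂ) := fun x => rfl
  have hS₂ : ∀ x, S₂ x = ((b₂ x : ℝ) : ℂ) := fun x => rfl
  have h12 : ∀ x, S₂ x * S₁ x = S₁ x := fun x => by
    rw [hS₁, hS₂]
    by_cases hx : x ∈ Metric.closedBall (0 : V) 2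
    · rw [b₂.one_of_mem_closedBall hx]; simp
    · rw [b₁.zero_of_le_dist (by simpa [b₁] using (not_le.1 (by simpa using hx)).le)]; simp
  have hpi : 0 < 2 * Real.pi := by positivity
  set n := Module.finrank ℝ V
  have hψ : ∀ y, (𝓕⁻ S₁) y =
      ∫ ζ, (((2 * Real.pi) ^ n)⁻¹ : ℝ) * S₁ ((2 * Real.pi)⁻¹ • ζ) * planeWave ζ y := fun y => by
    rw [fourierInv_coe, Real.fourierInv_eq']
    have := Measure.integral_comp_smul (volume : Measure V)
      (fun ζ => (((2 * Real.pi) ^ n)⁻¹ : ℝ) * S₁ ((2 * Real.pi)⁻¹ • ζ) * planeWave ζ y)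
      (2 * Real.pi)
    have h3 : (∫ ζ, (((2 * Real.pi) ^ n)⁻¹ : ℝ) * S₁ ((2 * Real.pi)⁻¹ • ζ) * planeWave ζ y) =
      (((2 * Real.pi) ^ n : ℝ) : ℂ) * ∫ ζ, (((2 * Real.pi) ^ n)⁻¹ : ℝ) *
        S₁ ((2 * Real.pi)⁻¹ • (2 * Real.pi) • ζ) * planeWave ((2 * Real.pi) • ζ) y := by
      rw [this, abs_of_pos (by positivity), Complex.real_smul, ← mul_assoc,
        ← Complex.ofReal_mul, mul_inv_cancel₀ (by positivity), Complex.ofReal_one, one_mul]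
    rw [h3, ← integral_const_mul]
    congr 1
    ext ζ
    rw [inv_smul_smul₀ hpi.ne', planeWave, real_inner_smul_right, real_inner_comm, smul_eq_mul,
      ← mul_assoc, ← mul_assoc, ← Complex.ofReal_mul, mul_inv_cancel₀ (by positivity)]
    push_cast
    ring
  -- The frequency radius is `2π` times the outer radius `2` of `b₁`, because `planeWave` omits the
  -- `2π` of the Fourier kernel.
  refine ⟨𝓕⁻ S₁, 𝓕⁻ S₂,
    fun ζ => (((2 * Real.pi) ^ n)⁻¹ : ℝ) * S₁ ((2 * Real.pi)⁻¹ • ζ), 2 * Real.pi * 2,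
    fun y => ?_, ?_, ?_, fun ζ hζ => ?_, hψ⟩
  · have hmul : SchwartzMap.convolution (ContinuousLinearMap.mul ℂ ℂ) (𝓕⁻ S₂) (𝓕⁻ S₁) = 𝓕⁻ S₁ := by
      refine (FourierTransform.fourierInv_fourier_eq (F := 𝓢(V, ℂ))
        (SchwartzMap.convolution (ContinuousLinearMap.mul ℂ ℂ) (𝓕⁻ S₂) (𝓕⁻ S₁))).symm.trans ?_
      congr 1
      rw [SchwartzMap.fourier_convolution]
      ext x
      simp [SchwartzMap.pairing_apply_apply, h12]
    have := SchwartzMap.convolution_apply (ContinuousLinearMap.mul ℂ ℂ) (𝓕⁻ S₂) (𝓕⁻ S₁) y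
    rw [hmul] at this
    rw [this]
    rfl
  · rw [fourierInv_coe, Real.fourierInv_eq']
    simp only [inner_zero_right, mul_zero, Complex.ofReal_zero, zero_mul, Complex.exp_zero,
      one_smul]
    simp_rw [hS₁]
    rw [integral_complex_ofReal]
    exact_mod_cast b₁.integral_pos.ne'
  · exact (S₁.integrable.comp_smul (by positivity)).const_mul _
  · dsimp only
    rw [hS₁, b₁.zero_of_le_dist]
    · simp
    · rw [dist_zero_right, norm_smul, norm_inv, Real.norm_of_nonneg hpi.le, ← div_eq_inv_mul,
        le_div_iff₀ hpi, mul_comm]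
      exact hζ.le

/-- The equality is known with the cutoff `ψ (t • y)`, but the admissible `t` depends on the
frequency range. The fixed weight `|ψ(x + ·)|²` is band-limited and integrable, so for each `ξ` it
can be inserted first and `t → 0` taken afterwards. -/
theorem integral_norm_sq_mul_planeWave_eq {ℓ : V →L[ℝ] ℝ} {m₁ m₂ η : Measure V} [SFinite m₁]
    [SFinite m₂] [IsFiniteMeasure η] (hm₁ : StripBounded ℓ m₁) (hm₂ : StripBounded ℓ m₂)
    (hconv : (η.prod m₁).map (fun p => p.1 + p.2) = (η.prod m₂).map fun p => p.1 + p.2)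
    (hη : ∀ ξ, charFun η ξ ≠ 0) {ψ χ : 𝓢(V, ℂ)} {b : V → ℂ} {r : ℝ}
    (hrep : ∀ y, ∫ z, χ z * ψ (y - z) = ψ y) (hψ0 : ψ 0 ≠ 0) (hb : Integrable b)
    (hbr : ∀ ζ, r < ‖ζ‖ → b ζ = 0) (hψ : ∀ y, ψ y = ∫ ζ, b ζ * planeWave ζ y) (x ξ : V) :
    ∫ y, ψ (x + y) * conj (ψ (x + y)) * planeWave ξ y ∂m₁ =
      ∫ y, ψ (x + y) * conj (ψ (x + y)) * planeWave ξ y ∂m₂ := by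
  have hψc := ψ.continuous
  obtain ⟨C, hC⟩ : ∃ C : ℝ, ∀ y, ‖ψ y‖ ≤ C := by
    obtain ⟨C, _, hC⟩ := ψ.decay 0 0
    exact ⟨C, fun y => by simpa using hC y⟩
  have hg : ∀ y, ψ (x + y) = ∫ ζ, (b ζ * planeWave ζ x) * planeWave ζ y := fun y => by
    simp_rw [hψ, planeWave_add, mul_assoc]
  have hg' : ∀ y, conj (ψ (x + y)) =
      ∫ ζ, conj (b (-ζ) * planeWave (-ζ) x) * planeWave ζ y := fun y => by
    rw [← integral_neg_eq_self, hg, ← integral_conj]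
    simp only [map_mul, conj_planeWave, neg_neg]
  have hgi : Integrable fun ζ => b ζ * planeWave ζ x :=
    hb.mul_bdd (c := 1) (Continuous.aestronglyMeasurable (by fun_prop))
      (.of_forall fun z => by simp)
  have hgi' : Integrable fun ζ => conj (b (-ζ) * planeWave (-ζ) x) :=
    (LinearIsometryEquiv.integrable_comp_iff Complex.conjLIE).2 hgi.comp_neg
  have hint : ∀ (m : Measure V) [SFinite m], StripBounded ℓ m → ∀ t : ℝ, 0 < t →
      Integrable (fun y => ψ (t • y)) m := fun m _ hm t ht => by
    obtain ⟨B, -, hB⟩ := (ψ.stripDecay_comp_smul ℓ ht).exists_integral_norm_le hm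
    simpa using (hB 0).1
  have hint₂ : ∀ (m : Measure V) [SFinite m], StripBounded ℓ m → ∀ t : ℝ, 0 < t →
      Integrable (fun y => ψ (t • y) * ψ (x + y)) m := fun m _ hm t ht =>
    (hint m hm t ht).mul_bdd (c := C) (Continuous.aestronglyMeasurable (by fun_prop))
      (.of_forall fun z => hC _)
  have hev : ∀ᶠ t : ℝ in 𝓝[>] 0,
      ∫ y, ψ (t • y) * ψ (x + y) * conj (ψ (x + y)) * planeWave ξ y ∂m₁ =
        ∫ y, ψ (t • y) * ψ (x + y) * conj (ψ (x + y)) * planeWave ξ y ∂m₂ := by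
    -- Each of the factors `ψ (x + y)` and its conjugate uses up one `r`.
    filter_upwards [eventually_integral_mul_planeWave_eq hm₁ hm₂ hrep hconv hη (‖ξ‖ + r + r),
      self_mem_nhdsWithin] with t ht ht0
    simp_rw [hg']
    refine integral_mul_superposition_eq (r := r) (R := ‖ξ‖) (hint₂ m₁ hm₁ t ht0)
      (hint₂ m₂ hm₂ t ht0) hgi' (fun ζ hζ => by rw [hbr _ (by simpa using hζ)]; simp)
      (fun ξ' hξ' => ?_) ξ le_rfl
    simp_rw [hg]
    exact integral_mul_superposition_eq (hint m₁ hm₁ t ht0) (hint m₂ hm₂ t ht0) hgi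
      (fun ζ hζ => by rw [hbr _ hζ]; simp) ht ξ' hξ'
  have hlim : ∀ (m : Measure V) [SFinite m], StripBounded ℓ m →
      Tendsto (fun t : ℝ => ∫ y, ψ (t • y) * ψ (x + y) * conj (ψ (x + y)) * planeWave ξ y ∂m)
        (𝓝[>] 0) (𝓝 (∫ y, ψ 0 * ψ (x + y) * conj (ψ (x + y)) * planeWave ξ y ∂m)) :=
      fun m _ hm => by
    have hix : Integrable (fun y => ψ (x + y)) m := by
      obtain ⟨B, -, hB⟩ := (ψ.stripDecay_comp_smul ℓ one_pos).exists_integral_norm_le hm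
      simpa using (hB x).1
    refine tendsto_integral_filter_of_dominated_convergence (fun y => C * ‖ψ (x + y)‖ * C)
      (.of_forall fun t => Continuous.aestronglyMeasurable (by fun_prop)) ?_
      ((hix.norm.const_mul C).mul_const C) ?_
    · refine .of_forall fun t => .of_forall fun y => ?_
      simp only [norm_mul, norm_planeWave, mul_one, RCLike.norm_conj]
      have hC0 : 0 ≤ C := (norm_nonneg _).trans (hC 0)
      gcongr <;> exact hC _
    · refine .of_forall fun y => ?_
      have h : Continuous fun t : ℝ =>
        ψ (t • y) * ψ (x + y) * conj (ψ (x + y)) * planeWave ξ y := by fun_prop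
      simpa using (h.tendsto 0).mono_left (nhdsWithin_le_nhds (s := Set.Ioi 0))
  have heq := tendsto_nhds_unique ((hlim m₁ hm₁).congr' hev) (hlim m₂ hm₂)
  simp_rw [mul_assoc] at heq ⊢
  simp_rw [integral_const_mul] at heq
  exact mul_left_cancel₀ hψ0 heq

/-- Cancellation for convolutions: a finite measure with nowhere vanishing characteristic function
can be cancelled from convolutions with measures that are uniformly bounded on strips. -/
theorem eq_of_map_add_prod_eq {ℓ : V →L[ℝ] ℝ} {m₁ m₂ η : Measure V} [SFinite m₁]
    [SFinite m₂] [IsFiniteMeasure η] (hm₁ : StripBounded ℓ m₁) (hm₂ : StripBounded ℓ m₂)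
    (hconv : (η.prod m₁).map (fun p => p.1 + p.2) = (η.prod m₂).map fun p => p.1 + p.2)
    (hη : ∀ ξ, charFun η ξ ≠ 0) : m₁ = m₂ := by
  obtain ⟨ψ, χ, b, r, hrep, hψ0, hb, hbr, hψ⟩ := exists_schwartz_reproducing (V := V)
  have hψc := ψ.continuous
  obtain ⟨C, hC⟩ : ∃ C : ℝ, ∀ y, ‖ψ y‖ ≤ C := by
    obtain ⟨C, _, hC⟩ := ψ.decay 0 0
    exact ⟨C, fun y => by simpa using hC y⟩
  have hfin : ∀ (m : Measure V) [SFinite m], StripBounded ℓ m → ∀ x,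
      IsFiniteMeasure (m.withDensity fun y => (‖ψ (x + y)‖₊ * ‖ψ (x + y)‖₊ : NNReal)) :=
      fun m _ hm x => by
    have hix : Integrable (fun y => ψ (x + y)) m := by
      obtain ⟨B, -, hB⟩ := (ψ.stripDecay_comp_smul ℓ one_pos).exists_integral_norm_le hm
      simpa using (hB x).1
    have h2 : Integrable (fun y => ψ (x + y) * ψ (x + y)) m :=
      hix.mul_bdd (c := C) hix.1 (.of_forall fun y => hC _)
    refine isFiniteMeasure_withDensity (ne_of_lt ?_)
    simpa [HasFiniteIntegral, enorm_eq_nnnorm] using h2.2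
  have hdens : ∀ x, (m₁.withDensity fun y => (‖ψ (x + y)‖₊ * ‖ψ (x + y)‖₊ : NNReal)) =
      m₂.withDensity fun y => (‖ψ (x + y)‖₊ * ‖ψ (x + y)‖₊ : NNReal) := fun x => by
    have := hfin m₁ hm₁ x
    have := hfin m₂ hm₂ x
    refine Measure.ext_of_charFun (funext fun ξ => ?_)
    have hmeas : Measurable fun y => ‖ψ (x + y)‖₊ * ‖ψ (x + y)‖₊ :=
      Continuous.measurable (by fun_prop)
    rw [charFun_eq_integral_planeWave, charFun_eq_integral_planeWave,
      integral_withDensity_eq_integral_smul hmeas, integral_withDensity_eq_integral_smul hmeas]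
    have heq : ∀ y, (‖ψ (x + y)‖₊ * ‖ψ (x + y)‖₊) • planeWave ξ y =
        ψ (x + y) * conj (ψ (x + y)) * planeWave ξ y := fun y => by
      rw [RCLike.mul_conj, NNReal.smul_def, Complex.real_smul]
      push_cast
      simp [sq]
    simp_rw [heq]
    exact integral_norm_sq_mul_planeWave_eq hm₁ hm₂ hconv hη hrep hψ0 hb hbr hψ x ξ
  set c : ℝ≥0∞ := ∫⁻ x, ((‖ψ x‖₊ * ‖ψ x‖₊ : NNReal) : ℝ≥0∞) with hc
  have hc_top : c ≠ ∞ := by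
    have h2 : Integrable (fun y => ψ y * ψ y) :=
      ψ.integrable.mul_bdd (c := C) ψ.integrable.1 (.of_forall fun y => hC _)
    have := h2.2
    simp only [HasFiniteIntegral, enorm_eq_nnnorm, nnnorm_mul] at this
    exact this.ne
  have hc_zero : c ≠ 0 := by
    have hcont : Continuous fun x => ((‖ψ x‖₊ * ‖ψ x‖₊ : NNReal) : ℝ≥0∞) := by fun_prop
    rw [hc, Ne, lintegral_eq_zero_iff hcont.measurable, hcont.ae_eq_iff_eq _ continuous_zero]
    intro h
    have := congrFun h 0
    simp [hψ0] at this
  -- By Tonelli and translation invariance, averaging over `x` gives a constant density, so zeros of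
  -- `ψ` do no harm.
  have key : ∀ (m : Measure V) [SFinite m] (A : Set V), MeasurableSet A →
      ∫⁻ x, (m.withDensity fun y => (‖ψ (x + y)‖₊ * ‖ψ (x + y)‖₊ : NNReal)) A = c * m A :=
      fun m _ A hA => by
    simp_rw [withDensity_apply _ hA]
    rw [lintegral_lintegral_swap (Continuous.aemeasurable (by fun_prop))]
    simp_rw [lintegral_add_right_eq_self (fun x => ((‖ψ x‖₊ * ‖ψ x‖₊ : NNReal) : ℝ≥0∞))]
    rw [← hc]
    simp
  ext A hA
  have h1 := key m₁ A hA
  simp_rw [hdens, key m₂ A hA] at h1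
  exact ((ENNReal.mul_right_inj hc_zero hc_top).1 h1).symm

end Wiener

/-! ### Faces of the orthant and logarithmic coordinates -/

section LogCoordinates

variable {d : ℕ}

/-- The face of the nonnegative orthant on which exactly the coordinates in `S` are nonzero. -/
def orthantFace (S : Finset (Fin d)) : Set (Fin d → ℝ) :=
  {x | ∀ k, if k ∈ S then 0 < x k else x k = 0}

/-- The coordinatewise logarithm of the coordinates in `S`, the others being sent to `0`. -/
noncomputable def logCoord (S : Finset (Fin d)) (x : Fin d → ℝ) : EuclideanSpace ℝ (Fin d) :=
  WithLp.toLp 2 fun k => if k ∈ S then Real.log (x k) else 0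

/-- The inverse of `logCoord S` on `orthantFace S`. -/
noncomputable def expCoord (S : Finset (Fin d)) (y : EuclideanSpace ℝ (Fin d)) : Fin d → ℝ :=
  fun k => if k ∈ S then Real.exp (y k) else 0

theorem measurableSet_orthantFace (S : Finset (Fin d)) : MeasurableSet (orthantFace S) := by
  simp only [orthantFace, Set.ofPred_forall]
  refine MeasurableSet.iInter fun k => ?_
  by_cases hk : k ∈ S
  · simpa [hk] using measurableSet_lt measurable_const (measurable_pi_apply k)
  · simpa [hk] using measurableSet_eq_fun (measurable_pi_apply k) measurable_const

theorem measurable_logCoord (S : Finset (Fin d)) : Measurable (logCoord S) := by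
  refine (WithLp.measurable_toLp 2 _).comp (measurable_pi_lambda _ fun k => ?_)
  by_cases hk : k ∈ S
  · simp only [hk, if_true]
    fun_prop
  · simp [hk]

theorem measurable_expCoord (S : Finset (Fin d)) : Measurable (expCoord S) := by
  refine measurable_pi_lambda _ fun k => ?_
  by_cases hk : k ∈ S
  · simp only [expCoord, hk, if_true]
    fun_prop
  · simp [expCoord, hk]

theorem expCoord_logCoord {S : Finset (Fin d)} {x : Fin d → ℝ} (hx : x ∈ orthantFace S) :
    expCoord S (logCoord S x) = x := by
  ext k
  have h := hx k
  by_cases hk : k ∈ S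
  · simp only [hk, if_true] at h
    simp [expCoord, logCoord, hk, Real.exp_log h]
  · simp only [hk, if_false] at h
    simp [expCoord, hk, h]

theorem mul_mem_orthantFace_iff {S : Finset (Fin d)} {x y : Fin d → ℝ} (hx : x ∈ posOrthant d) :
    (fun k => x k * y k) ∈ orthantFace S ↔ y ∈ orthantFace S := by
  refine forall_congr' fun k => ?_
  have := hx k
  by_cases hk : k ∈ S <;> simp [hk, this, this.ne']

theorem logCoord_mul {S : Finset (Fin d)} {x y : Fin d → ℝ} (hx : x ∈ posOrthant d)
    (hy : y ∈ orthantFace S) :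
    logCoord S (fun k => x k * y k) = logCoord S x + logCoord S y := by
  ext k
  have h := hy k
  by_cases hk : k ∈ S
  · simp only [hk, if_true] at h
    simp [logCoord, hk, Real.log_mul (hx k).ne' h.ne']
  · simp [logCoord, hk]

theorem iUnion_orthantFace : ⋃ S : Finset (Fin d), orthantFace S = nonnegOrthant d := by
  ext x
  simp only [Set.mem_iUnion]
  constructor
  · rintro ⟨S, hS⟩ k
    have := hS k
    split_ifs at this
    · exact this.le
    · exact this.ge
  · intro hx
    refine ⟨Finset.univ.filter fun k => 0 < x k, fun k => ?_⟩
    have := hx k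
    split_ifs with h
    · simpa using h
    · exact le_antisymm (by simpa using h) this

/-- The measure `x_j ^ a • μ` in logarithmic coordinates. -/
noncomputable def tiltedLog (S : Finset (Fin d)) (j : Fin d) (a : ℝ) (μ : Measure (Fin d → ℝ)) :
    Measure (EuclideanSpace ℝ (Fin d)) :=
  (μ.withDensity fun x => ENNReal.ofReal (x j ^ a)).map (logCoord S)

theorem measurable_ofReal_rpow_apply (j : Fin d) (a : ℝ) :
    Measurable fun x : Fin d → ℝ => ENNReal.ofReal (x j ^ a) := by
  fun_prop

instance sFinite_tiltedLog (S : Finset (Fin d)) (j : Fin d) (a : ℝ) (μ : Measure (Fin d → ℝ))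
    [SFinite μ] : SFinite (tiltedLog S j a μ) := by
  unfold tiltedLog
  infer_instance

theorem lintegral_tiltedLog (S : Finset (Fin d)) (j : Fin d) (a : ℝ) (μ : Measure (Fin d → ℝ))
    {f : EuclideanSpace ℝ (Fin d) → ℝ≥0∞} (hf : Measurable f) :
    ∫⁻ y, f y ∂tiltedLog S j a μ = ∫⁻ x, ENNReal.ofReal (x j ^ a) * f (logCoord S x) ∂μ := by
  rw [tiltedLog, lintegral_map hf (measurable_logCoord S),
    lintegral_withDensity_eq_lintegral_mul _ (measurable_ofReal_rpow_apply j a)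
      (show Measurable fun x => f (logCoord S x) from hf.comp (measurable_logCoord S))]
  rfl

/-- On `s < log x_j ≤ s + 1` the weight is at most `e ^ a (e ^ s) ^ a`, and the strip lies in `{x_j
> e ^ s}`: the tail bound at `e ^ s` applies. -/
theorem stripBounded_tiltedLog {S : Finset (Fin d)} {j : Fin d} (hj : j ∈ S) {a : ℝ} (ha : 0 < a)
    {ν : Measure (Fin d → ℝ)}
    (htail : (⨆ (s : ℝ) (_ : 0 < s), ENNReal.ofReal (s ^ a) * ν {x | s < x j}) < ∞) :
    StripBounded (EuclideanSpace.proj j) (tiltedLog S j a (ν.restrict (orthantFace S))) := by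
  refine ⟨ENNReal.ofReal (Real.exp a) *
    ⨆ (s : ℝ) (_ : 0 < s), ENNReal.ofReal (s ^ a) * ν {x | s < x j},
    ENNReal.mul_ne_top (by simp) htail.ne, fun s => ?_⟩
  have hB : MeasurableSet {y : EuclideanSpace ℝ (Fin d) |
      s < (EuclideanSpace.proj j : _ →L[ℝ] ℝ) y ∧ (EuclideanSpace.proj j : _ →L[ℝ] ℝ) y ≤ s + 1} :=
    (measurableSet_lt measurable_const (EuclideanSpace.proj j : _ →L[ℝ] ℝ).measurable).inter
      (measurableSet_le (EuclideanSpace.proj j : _ →L[ℝ] ℝ).measurable measurable_const)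
  have hT : MeasurableSet {x : Fin d → ℝ | Real.exp s < x j} :=
    measurableSet_lt measurable_const (measurable_pi_apply j)
  rw [← lintegral_indicator_one hB,
    lintegral_tiltedLog _ _ _ _ (measurable_one.indicator hB)]
  calc _ ≤ ∫⁻ x in orthantFace S, ENNReal.ofReal (Real.exp a) * ENNReal.ofReal (Real.exp s ^ a) *
        Set.indicator {x : Fin d → ℝ | Real.exp s < x j} 1 x ∂ν := by
        refine setLIntegral_mono' (measurableSet_orthantFace S) fun x hx => ?_
        have hxj : 0 < x j := by simpa [hj] using hx j
        by_cases h : s < Real.log (x j) ∧ Real.log (x j) ≤ s + 1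
        · have h1 : Real.exp s < x j := (Real.lt_log_iff_exp_lt hxj).1 h.1
          have h2 : x j ≤ Real.exp (s + 1) := (Real.log_le_iff_le_exp hxj).1 h.2
          rw [Set.indicator_of_mem (by simpa [logCoord, hj] using h),
            Set.indicator_of_mem (by exact h1), ← ENNReal.ofReal_mul (Real.exp_nonneg _)]
          simp only [Pi.one_apply, mul_one]
          refine ENNReal.ofReal_le_ofReal ?_
          calc x j ^ a ≤ Real.exp (s + 1) ^ a := by gcongr
            _ = _ := by rw [← Real.exp_mul, ← Real.exp_mul, ← Real.exp_add]; ring_nf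
        · rw [Set.indicator_of_notMem (by simpa [logCoord, hj] using h)]
          simp
    _ ≤ ∫⁻ x, ENNReal.ofReal (Real.exp a) * ENNReal.ofReal (Real.exp s ^ a) *
        Set.indicator {x : Fin d → ℝ | Real.exp s < x j} 1 x ∂ν :=
        lintegral_mono' Measure.restrict_le_self le_rfl
    _ = ENNReal.ofReal (Real.exp a) *
        (ENNReal.ofReal (Real.exp s ^ a) * ν {x | Real.exp s < x j}) := by
        rw [lintegral_const_mul _ (measurable_one.indicator hT), lintegral_indicator_one hT,
          mul_assoc]
    _ ≤ _ := by
        gcongr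
        exact le_iSup₂ (f := fun (s : ℝ) (_ : 0 < s) => ENNReal.ofReal (s ^ a) * ν {x | s < x j})
          (Real.exp s) (Real.exp_pos s)

/-- The weight is multiplicative, the logarithm turns products into sums, and a positive factor
neither leaves nor enters a face. -/
theorem map_add_tiltedLog {S : Finset (Fin d)} {j : Fin d} (a : ℝ)
    {ρ ν : Measure (Fin d → ℝ)} [SFinite ρ] [SFinite ν] (hρ : ρ (posOrthant d)ᶜ = 0) :
    ((tiltedLog S j a ρ).prod (tiltedLog S j a (ν.restrict (orthantFace S)))).map
        (fun p => p.1 + p.2) =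
      tiltedLog S j a ((multConv ν ρ).restrict (orthantFace S)) := by
  refine Measure.ext_of_lintegral _ fun f hf => ?_
  have hadd : Measurable fun p : EuclideanSpace ℝ (Fin d) × EuclideanSpace ℝ (Fin d) =>
      f (p.1 + p.2) := hf.comp (by fun_prop)
  have hS := measurableSet_orthantFace S
  have hw := measurable_ofReal_rpow_apply j a
  have hmul : Measurable fun (p : (Fin d → ℝ) × (Fin d → ℝ)) (k : Fin d) => p.1 k * p.2 k := by
    fun_prop
  have hH : Measurable ((orthantFace S).indicator
      fun z => ENNReal.ofReal (z j ^ a) * f (logCoord S z)) :=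
    (hw.mul (hf.comp (measurable_logCoord S))).indicator hS
  rw [lintegral_map hf (by fun_prop), lintegral_prod _ hadd.aemeasurable,
    lintegral_tiltedLog _ _ _ _ hadd.lintegral_prod_right', lintegral_tiltedLog _ _ _ _ hf,
    ← lintegral_indicator hS, multConv, lintegral_map hH hmul,
    lintegral_prod _ (by exact (hH.comp hmul).aemeasurable)]
  have hpos : ∀ᵐ x ∂ρ, x ∈ posOrthant d := hρ
  refine lintegral_congr_ae ?_
  filter_upwards [hpos] with x hx
  have hfx : Measurable fun v => f (logCoord S x + v) := hf.comp (by fun_prop)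
  rw [lintegral_tiltedLog _ _ _ _ hfx, ← lintegral_indicator hS,
    ← lintegral_const_mul _
      (by exact (hw.mul (hfx.comp (measurable_logCoord S))).indicator hS)]
  refine lintegral_congr fun y => ?_
  by_cases hy : y ∈ orthantFace S
  · have hy0 : 0 ≤ y j := by
      have := hy j
      split_ifs at this
      · exact this.le
      · exact this.ge
    rw [Set.indicator_of_mem hy, Set.indicator_of_mem ((mul_mem_orthantFace_iff hx).2 hy),
      logCoord_mul hx hy, Real.mul_rpow (hx j).le hy0,
      ENNReal.ofReal_mul (Real.rpow_nonneg (hx j).le _), mul_assoc]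
  · rw [Set.indicator_of_notMem hy, Set.indicator_of_notMem (mt (mul_mem_orthantFace_iff hx).1 hy),
      mul_zero]

/-- Since `j ∈ S`, the weight is positive on the face and can be divided out after undoing the
logarithm. -/
theorem restrict_orthantFace_eq_of_tiltedLog_eq {S : Finset (Fin d)} {j : Fin d} (hj : j ∈ S)
    {a : ℝ} {ν₁ ν₂ : Measure (Fin d → ℝ)}
    (h : tiltedLog S j a (ν₁.restrict (orthantFace S)) =
      tiltedLog S j a (ν₂.restrict (orthantFace S))) :
    ν₁.restrict (orthantFace S) = ν₂.restrict (orthantFace S) := by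
  have hw := measurable_ofReal_rpow_apply j a
  have key : ∀ ν : Measure (Fin d → ℝ),
      ((tiltedLog S j a (ν.restrict (orthantFace S))).map (expCoord S)).withDensity
        (fun x => (ENNReal.ofReal (x j ^ a))⁻¹) = ν.restrict (orthantFace S) := fun ν => by
    have hmem : ∀ᵐ x ∂ν.restrict (orthantFace S), x ∈ orthantFace S :=
      ae_restrict_mem (measurableSet_orthantFace S)
    rw [tiltedLog, Measure.map_map (measurable_expCoord S) (measurable_logCoord S),
      Measure.map_congr (g := id), Measure.map_id]
    · refine withDensity_inv_same hw ?_ (.of_forall fun _ => ENNReal.ofReal_ne_top)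
      filter_upwards [hmem] with x hx
      have hxj : 0 < x j := by simpa [hj] using hx j
      simpa using Real.rpow_pos_of_pos hxj a
    · filter_upwards [(withDensity_absolutelyContinuous _ _).ae_le hmem] with x hx
      exact expCoord_logCoord hx
  rw [← key ν₁, h, key ν₂]

/-- As `x ^ (iθ) = exp (iθ log x)`, this is the integral assumed nonzero, with `θ` equal to `ξ` on
`S` and `0` elsewhere. -/
theorem charFun_tiltedLog {S : Finset (Fin d)} {j : Fin d} (a : ℝ)
    {ρ : Measure (Fin d → ℝ)} (hρ : ρ (posOrthant d)ᶜ = 0) (ξ : EuclideanSpace ℝ (Fin d)) :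
    charFun (tiltedLog S j a ρ) ξ =
      ∫ x in posOrthant d, ((x j ^ a : ℝ) : ℂ) *
        ∏ k, (x k : ℂ) ^ (Complex.I * ((if k ∈ S then ξ k else 0 : ℝ) : ℂ)) ∂ρ := by
  have hpos : ∀ᵐ x ∂ρ, x ∈ posOrthant d := hρ
  rw [Measure.restrict_eq_self_of_ae_mem hpos, charFun_eq_integral_planeWave, tiltedLog,
    integral_map (measurable_logCoord S).aemeasurable
      (Continuous.aestronglyMeasurable (by fun_prop)),
    integral_withDensity_eq_integral_toReal_smul (measurable_ofReal_rpow_apply j a)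
      (.of_forall fun _ => ENNReal.ofReal_lt_top)]
  refine integral_congr_ae ?_
  filter_upwards [hpos] with x hx
  rw [ENNReal.toReal_ofReal (Real.rpow_nonneg (hx j).le _), Complex.real_smul, planeWave,
    PiLp.inner_apply]
  congr 1
  push_cast
  rw [Finset.sum_mul, Complex.exp_sum]
  refine Finset.prod_congr rfl fun k _ => ?_
  rw [Complex.cpow_def_of_ne_zero (by exact_mod_cast (hx k).ne'), ← Complex.ofReal_log (hx k).le]
  congr 1
  by_cases hk : k ∈ S
  · simp [logCoord, hk]
    ring
  · simp [logCoord, hk]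

end LogCoordinates

/-! ### The theorem, face by face -/

theorem mainTheorem12 {d : ℕ} (α : Fin d → ℝ) (hα : ∀ k, 0 < α k)
    (ρ ν₁ ν₂ : Measure (Fin d → ℝ)) [SigmaFinite ρ] [SigmaFinite ν₁] [SigmaFinite ν₂]
    (hρ : ρ (posOrthant d)ᶜ = 0)
    (hν₁ : ν₁ (nonnegOrthant d)ᶜ = 0) (hν₂ : ν₂ (nonnegOrthant d)ᶜ = 0)
    (K : Set (Fin d)) (hK : K.Nonempty)
    (hsupp₁ : ν₁ {x | ∀ k ∈ K, x k = 0} = 0) (hsupp₂ : ν₂ {x | ∀ k ∈ K, x k = 0} = 0)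
    (hmom : ∀ j ∈ K, (∫⁻ x in posOrthant d, ENNReal.ofReal (x j ^ α j) ∂ρ) < ∞)
    (htail₁ : ∀ j ∈ K,
      (⨆ (s : ℝ) (_ : 0 < s), ENNReal.ofReal (s ^ α j) * ν₁ {x | s < x j}) < ∞)
    (htail₂ : ∀ j ∈ K,
      (⨆ (s : ℝ) (_ : 0 < s), ENNReal.ofReal (s ^ α j) * ν₂ {x | s < x j}) < ∞)
    (hconv : multConv ν₁ ρ = multConv ν₂ ρ)
    (hcancel : ∀ j ∈ K, ∀ θ : Fin d → ℝ,
      (∫ x in posOrthant d,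
        ((x j ^ α j : ℝ) : ℂ) * ∏ k, (x k : ℂ) ^ (Complex.I * (θ k : ℂ)) ∂ρ) ≠ 0) :
    ν₁ = ν₂ := by
  have hpos : ∀ᵐ x ∂ρ, x ∈ posOrthant d := hρ
  rw [← Measure.restrict_eq_self_of_ae_mem (show ∀ᵐ x ∂ν₁, x ∈ nonnegOrthant d from hν₁),
    ← Measure.restrict_eq_self_of_ae_mem (show ∀ᵐ x ∂ν₂, x ∈ nonnegOrthant d from hν₂),
    ← iUnion_orthantFace, Measure.restrict_iUnion_congr]
  intro S
  by_cases hSK : ∃ j ∈ K, j ∈ S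
  · obtain ⟨j, hjK, hjS⟩ := hSK
    have : IsFiniteMeasure (tiltedLog S j (α j) ρ) := by
      have h := hmom j hjK
      rw [Measure.restrict_eq_self_of_ae_mem hpos] at h
      have := isFiniteMeasure_withDensity h.ne
      unfold tiltedLog
      infer_instance
    refine restrict_orthantFace_eq_of_tiltedLog_eq hjS (a := α j)
      (eq_of_map_add_prod_eq (η := tiltedLog S j (α j) ρ)
        (stripBounded_tiltedLog hjS (hα j) (htail₁ j hjK))
        (stripBounded_tiltedLog hjS (hα j) (htail₂ j hjK)) ?_ fun ξ => ?_)
    · rw [map_add_tiltedLog _ hρ, map_add_tiltedLog _ hρ, hconv]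
    · rw [charFun_tiltedLog _ hρ]
      exact hcancel j hjK _
  -- A face disjoint from `K` in this sense offers no direction to tilt in; the first hypothesis
  -- makes it null.
  · have hsub : orthantFace S ⊆ {x | ∀ k ∈ K, x k = 0} := fun x hx k hk => by
      have hkS : k ∉ S := fun h => hSK ⟨k, hk, h⟩
      simpa [hkS] using hx k
    rw [Measure.restrict_eq_zero.2 (measure_mono_null hsub hsupp₁),
      Measure.restrict_eq_zero.2 (measure_mono_null hsub hsupp₂)]
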